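/- Let $\varepsilon>0$ and $k\ge 1$, and let $h:[0,\infty)\to[0,\infty)$ be continuous and increasing with $h(0)=0$, and such that for some $B>0$ the function $\log h$ is well defined and Lipschitz on $[B,\infty)$. Users are the real numbers $u\in\mathbb R$, and the disutility of user $u$ from a result $a\in\mathbb R$ is $h(|u-a|)$. A mechanism $(Z,\mathbf P,\mathbf Q)$ consists of a measurable space $Z$ of signals, a family $\mathbf P=(P_u)_{u\in\mathbb R}$ of probability measures on $Z$ (user $u$ sends a signal $s\sim P_u$), and a Markov kernel $\mathbf Q=(Q_s)_{s\in Z}$ from $Z$ to $\mathbb R^k$ (on receiving $s$ the server returns $k$ results $a=(a_1,\dots,a_k)\sim Q_s$). Let $\mathcal P^{(\varepsilon)}_Z$ be the set of those $\mathbf P$ that are $\varepsilon$-geographically differentially private, i.e. $P_{u_1}(S)\le e^{\varepsilon|u_1-u_2|}P_{u_2}(S)$ for all $u_1,u_2\in\mathbb R$ and all measurable $S\subseteq Z$. The cost of a mechanism is $$\mathrm{cost}(Z,\mathbf P,\mathbf Q)=\sup_{u\in\mathbb R}\ \mathbb E_{s\sim P_u}\,\mathbb E_{a\sim Q_s}\Big[\min_{1\le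 i\le k}h(|u-a_i|)\Big]\in[0,\infty],$$ and the optimal multi-selection cost is $$f(\varepsilon,k)=\inf_{Z}\ \inf_{\mathbf P\in\mathcal P^{(\varepsilon)}_Z}\ \inf_{\mathbf Q}\ \mathrm{cost}(Z,\mathbf P,\mathbf Q).$$ Let $\mathcal L_\varepsilon(u)$ be the Laplace distribution of scale $1/\varepsilon$ centred at $u$, with density $x\mapsto\frac{\varepsilon}{2}e^{-\varepsilon|x-u|}$, and put $$\hat f(\varepsilon,k)=\min_{a\in\mathbb R^k}\ \mathbb E_{y\sim\mathcal L_\varepsilon(0)}\Big[\min_{1\le i\le k}h(|y-a_i|)\Big].$$ Then the minimum defining $\hat f(\varepsilon,k)$ is attained (possibly with value $\infty$). The Laplace action $\mathbf P^{\mathcal L}=(\mathcal L_\varepsilon(u))_{u\in\mathbb R}$, with signal space $Z=\mathbb R$, belongs to $\mathcal P^{(\varepsilon)}_{\mathbb R}$ and is an optimal choice for the users: $$\inf_{\mathbf Q}\mathrm{cost}(\mathbb R,\mathbf P^{\mathcal L},\mathbf Q)=f(\varepsilon,k),$$ and this infimum is attained by some $\mathbf Q$. Moreover $$f(\varepsilon,k)=\hat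 f(\varepsilon,k).$$ -/

import Mathlib

open MeasureTheory ProbabilityTheory
open scoped ENNReal NNReal

universe v

/-- Admissible disutility profiles: `h` is continuous and increasing on `[0, ∞)`, `h 0 = 0`, and
there is `B > 0` such that `log h` is (well defined and) Lipschitz on `[B, ∞)`.
Only the values of `h` on `[0, ∞)` matter. -/
structure Admissible (h : ℝ → ℝ) : Prop where
  continuousOn : ContinuousOn h (Set.Ici 0)
  monotoneOn : MonotoneOn h (Set.Ici 0)
  map_zero : h 0 = 0
  log_lipschitz : ∃ B : ℝ, 0 < B ∧ (∀ x ∈ Set.Ici B, 0 < h x) ∧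
    ∃ K : ℝ≥0, LipschitzOnWith K (fun x => Real.log (h x)) (Set.Ici B)

/-- The Laplace distribution on `ℝ` of scale `1 / ε` centred at `u`. -/
noncomputable def laplace (ε u : ℝ) : Measure ℝ :=
  volume.withDensity fun x => ENNReal.ofReal (ε / 2 * Real.exp (-ε * |x - u|))

/-- `ε`-geographic differential privacy of a family of distributions on the signal space `Z`,
indexed by the users `u : ℝ`. -/
def GeoDP {Z : Type*} [MeasurableSpace Z] (ε : ℝ) (P : ℝ → Measure Z) : Prop :=
  ∀ u₁ u₂ : ℝ, ∀ S : Set Z, MeasurableSet S →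
    P u₁ S ≤ ENNReal.ofReal (Real.exp (ε * |u₁ - u₂|)) * P u₂ S

/-- The user actions with signal space `Z` that are `ε`-geographically differentially private:
every user sends a random signal in `Z`, and the privacy constraint holds. -/
def userActions (ε : ℝ) (Z : Type*) [MeasurableSpace Z] : Set (ℝ → Measure Z) :=
  {P | (∀ u, IsProbabilityMeasure (P u)) ∧ GeoDP ε P}

/-- The smallest disutility `min_i h(|u - a i|)` of the user `u` among the results
`a 0, …, a (k - 1)`. -/
noncomputable def minDisutility {k : ℕ} (h : ℝ → ℝ) (u : ℝ) (a : Fin k → ℝ) : ℝ≥0∞ :=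
  ⨅ i, ENNReal.ofReal (h |u - a i|)

/-- The cost of the user `u` for user actions `P` and server response `Q`:
`E_{s ∼ P u} E_{a ∼ Q s} min_i h(|u - a i|)`. -/
noncomputable def userCost {Z : Type*} [MeasurableSpace Z] {k : ℕ} (h : ℝ → ℝ)
    (P : ℝ → Measure Z) (Q : Kernel Z (Fin k → ℝ)) (u : ℝ) : ℝ≥0∞ :=
  ∫⁻ s, ∫⁻ a, minDisutility h u a ∂(Q s) ∂(P u)

/-- The cost of a mechanism: the supremum over all users of the cost of the user. -/
noncomputable def cost {Z : Type*} [MeasurableSpace Z] {k : ℕ} (h : ℝ → ℝ)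
    (P : ℝ → Measure Z) (Q : Kernel Z (Fin k → ℝ)) : ℝ≥0∞ :=
  ⨆ u : ℝ, userCost h P Q u

/-- The smallest cost that a server returning `k` results can reach against user actions `P`. -/
noncomputable def bestResponseCost {Z : Type*} [MeasurableSpace Z] (k : ℕ) (h : ℝ → ℝ)
    (P : ℝ → Measure Z) : ℝ≥0∞ :=
  ⨅ (Q : Kernel Z (Fin k → ℝ)) (_ : IsMarkovKernel Q), cost h P Q

/-- The optimal multi-selection cost `f(ε, k)`: the infimum of the cost over all measurable signal
spaces, all private user actions and all server responses. -/
noncomputable def optimalCost (ε : ℝ) (k : ℕ) (h : ℝ → ℝ) : ℝ≥0∞ :=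
  ⨅ (Z : Type v) (_ : MeasurableSpace Z) (P : ℝ → Measure Z) (_ : P ∈ userActions ε Z),
    bestResponseCost k h P

/-- The expected smallest disutility of `k` fixed results `a` for a user drawn from the Laplace
distribution of scale `1 / ε` centred at `0`. -/
noncomputable def laplaceObjective {k : ℕ} (ε : ℝ) (h : ℝ → ℝ) (a : Fin k → ℝ) : ℝ≥0∞ :=
  ∫⁻ y, minDisutility h y a ∂(laplace ε 0)

/-- `f̂(ε, k)`: the optimal value of the placement of `k` points against Laplace noise. -/
noncomputable def fHat (ε : ℝ) (k : ℕ) (h : ℝ → ℝ) : ℝ≥0∞ :=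
  ⨅ a : Fin k → ℝ, laplaceObjective ε h a

/-!
A mechanism acts on costs only through the distribution `R u` of the results that user `u` is
given, and `R` is again private. Draw the user from noise of a very wide scale `1 / δ`. Then the
density of the pair of user and results is, at fixed results `a`, an `(ε + δ)`-log-Lipschitz
function `ρ` of the user, so the lower bound reduces to
`f̂(ε + δ) * ∫ ρ ≤ ∫ min_i h(|u - a i|) ρ(u) du`.

Up to the factor `exp (∓(ε + δ) u)` a log-Lipschitz `ρ` is monotone, so on each half-line such an
inequality can be tested on exponential tails. It then says that the disutilities along a left tail
from `p` and a right tail from `q ≥ p` add up to at least `2 f̂`, which follows by contracting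
`[p, q]` to a point: this brings no result farther from any user and joins the tails to a Laplace
distribution. Compactness of `[-∞, ∞]^k` makes `f̂` lower semicontinuous, and `δ → 0` gives the
bound `f̂(ε)`. The server attains it by adding minimising offsets to a Laplace signal.
-/

open Filter Topology

lemma ofReal_exp_add (x y : ℝ) :
    ENNReal.ofReal (Real.exp (x + y)) =
      ENNReal.ofReal (Real.exp x) * ENNReal.ofReal (Real.exp y) := by
  rw [Real.exp_add, ENNReal.ofReal_mul (Real.exp_nonneg x)]

/-- The multiplicative form of `ε`-Lipschitz continuity of `log ρ`, which also makes sense where `ρ`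
takes the values `0` and `∞`. It is the privacy constraint, read for one event or one density at a
time. -/
def LogLipschitz (ε : ℝ) (ρ : ℝ → ℝ≥0∞) : Prop :=
  ∀ u v, ρ u ≤ ENNReal.ofReal (Real.exp (ε * |u - v|)) * ρ v

lemma logLipschitz_ofReal_exp {ε : ℝ} {g : ℝ → ℝ} (hg : ∀ u v, g u ≤ ε * |u - v| + g v) :
    LogLipschitz ε fun u => ENNReal.ofReal (Real.exp (g u)) := fun u v => by
  rw [← ofReal_exp_add]
  exact ENNReal.ofReal_le_ofReal (Real.exp_le_exp.2 (hg u v))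

namespace LogLipschitz

variable {ε δ : ℝ} {ρ σ : ℝ → ℝ≥0∞}

lemma const_mul (hρ : LogLipschitz ε ρ) (c : ℝ≥0∞) : LogLipschitz ε fun u => c * ρ u :=
  fun u v => (mul_le_mul_right (hρ u v) c).trans_eq (mul_left_comm _ _ _)

lemma mul_const (hρ : LogLipschitz ε ρ) (c : ℝ≥0∞) : LogLipschitz ε fun u => ρ u * c :=
  fun u v => (mul_le_mul_left (hρ u v) c).trans_eq (mul_assoc _ _ _)

lemma mul (hρ : LogLipschitz ε ρ) (hσ : LogLipschitz δ σ) :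
    LogLipschitz (ε + δ) fun u => ρ u * σ u := fun u v => by
  rw [add_mul, ofReal_exp_add, mul_mul_mul_comm]
  exact mul_le_mul' (hρ u v) (hσ u v)

lemma iInf {ι : Sort*} {ρ : ι → ℝ → ℝ≥0∞} (hρ : ∀ i, LogLipschitz ε (ρ i)) :
    LogLipschitz ε fun u => ⨅ i, ρ i u := fun u v => by
  rw [ENNReal.mul_iInf_of_ne (by simp [Real.exp_pos]) ENNReal.ofReal_ne_top]
  exact iInf_mono fun i => hρ i u v

lemma lintegral {Y : Type*} [MeasurableSpace Y] {r : ℝ → Y → ℝ≥0∞}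
    (hr : ∀ a, LogLipschitz ε fun u => r u a) (μ : Measure Y) :
    LogLipschitz ε fun u => ∫⁻ a, r u a ∂μ := fun u v => by
  rw [← lintegral_const_mul' _ _ ENNReal.ofReal_ne_top]
  exact lintegral_mono fun a => hr a u v

lemma comp_neg (hρ : LogLipschitz ε ρ) : LogLipschitz ε fun u => ρ (-u) := fun u v => by
  simpa only [neg_sub_neg, abs_sub_comm] using hρ (-u) (-v)

lemma exp_neg_mul_le (hρ : LogLipschitz ε ρ) (u v : ℝ) :
    ENNReal.ofReal (Real.exp (-(ε * |u - v|))) * ρ u ≤ ρ v := by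
  refine (mul_le_mul_right (hρ u v) _).trans_eq ?_
  rw [← mul_assoc, ← ofReal_exp_add, neg_add_cancel, Real.exp_zero, ENNReal.ofReal_one,
    one_mul]

protected lemma continuous (hρ : LogLipschitz ε ρ) : Continuous ρ := by
  refine continuous_iff_continuousAt.2 fun u => ?_
  have hlim {g : ℝ → ℝ} (hg : Continuous g) (hgu : g u = 0) :
      Tendsto (fun v => ENNReal.ofReal (Real.exp (g v)) * ρ u) (𝓝 u) (𝓝 (ρ u)) := by
    have hexp : Continuous fun v => ENNReal.ofReal (Real.exp (g v)) :=
      ENNReal.continuous_ofReal.comp (Real.continuous_exp.comp hg)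
    simpa [hgu] using ENNReal.Tendsto.mul_const (hexp.tendsto u) (Or.inl (by simp [hgu]))
  exact tendsto_of_tendsto_of_tendsto_of_le_of_le
    (hlim (g := fun v => -(ε * |u - v|)) (by fun_prop) (by simp))
    (hlim (g := fun v => ε * |v - u|) (by fun_prop) (by simp))
    (fun v => hρ.exp_neg_mul_le u v) (fun v => hρ v u)

lemma monotone_exp_mul (hρ : LogLipschitz ε ρ) :
    Monotone fun u => ENNReal.ofReal (Real.exp (ε * u)) * ρ u := fun u v huv => by
  refine (mul_le_mul_right (hρ u v) _).trans_eq ?_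
  rw [← mul_assoc, ← ofReal_exp_add, abs_of_nonpos (by linarith)]
  ring_nf

end LogLipschitz

lemma measure_le_of_isUpperSet {μ ν : Measure ℝ} {S : Set ℝ} (hS : IsUpperSet S)
    (h : ∀ t ∈ S, μ (Set.Ici t) ≤ ν (Set.Ici t)) : μ S ≤ ν S := by
  by_cases hmin : ∃ t, IsLeast S t
  · obtain ⟨t, ht⟩ := hmin
    obtain rfl : S = Set.Ici t := Set.Subset.antisymm ht.2 fun x hx => hS hx ht.1
    exact h t ht.1
  have hU : S = ⋃ q : {q : ℚ // (q : ℝ) ∈ S}, Set.Ici (q : ℝ) := by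
    refine Set.Subset.antisymm (fun x hx => ?_) (Set.iUnion_subset fun q x hx => hS hx q.2)
    obtain ⟨y, hy, hyx⟩ : ∃ y ∈ S, y < x := by
      by_contra! hle
      exact hmin ⟨x, hx, hle⟩
    obtain ⟨q, hyq, hqx⟩ := exists_rat_btwn hyx
    exact Set.mem_iUnion.2 ⟨⟨q, hS hyq.le hy⟩, hqx.le⟩
  have hdir : Directed (· ⊆ ·) fun q : {q : ℚ // (q : ℝ) ∈ S} => Set.Ici (q : ℝ) :=
    Antitone.directed_le fun p q hpq => Set.Ici_subset_Ici.2 (by exact_mod_cast hpq)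
  rw [hU, hdir.measure_iUnion, hdir.measure_iUnion]
  exact iSup_mono fun q => h _ q.2

lemma setLIntegral_le_of_monotone {μ ν : Measure ℝ} {U : Set ℝ} (hU : IsUpperSet U)
    (hμν : ∀ t ∈ U, μ (Set.Ici t) ≤ ν (Set.Ici t)) {f : ℝ → ℝ≥0∞} (hf : Monotone f) :
    ∫⁻ x in U, f x ∂μ ≤ ∫⁻ x in U, f x ∂ν := by
  -- Layer cake, applied to the truncations of `f` because Mathlib states it for real integrands.
  have htrunc (n : ℕ) : ∫⁻ x in U, min (f x) n ∂μ ≤ ∫⁻ x in U, min (f x) n ∂ν := by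
    have htop (x : ℝ) : min (f x) (n : ℝ≥0∞) ≠ ∞ := by simp
    set g : ℝ → ℝ := fun x => (min (f x) n).toReal
    have hgmono : Monotone g := fun x y hxy =>
      ENNReal.toReal_mono (htop y) (min_le_min_right _ (hf hxy))
    have hg_eq (x : ℝ) : min (f x) (n : ℝ≥0∞) = ENNReal.ofReal (g x) :=
      (ENNReal.ofReal_toReal (htop x)).symm
    simp only [hg_eq]
    rw [lintegral_eq_lintegral_meas_lt _ (ae_of_all _ fun x => ENNReal.toReal_nonneg)
        hgmono.measurable.aemeasurable,
      lintegral_eq_lintegral_meas_lt _ (ae_of_all _ fun x => ENNReal.toReal_nonneg)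
        hgmono.measurable.aemeasurable]
    refine lintegral_mono fun s => ?_
    have hms : MeasurableSet {x | s < g x} := measurableSet_lt measurable_const hgmono.measurable
    have hup : IsUpperSet {x | s < g x} := fun x y hxy hx => hx.trans_le (hgmono hxy)
    rw [Measure.restrict_apply hms, Measure.restrict_apply hms]
    exact measure_le_of_isUpperSet (hup.inter hU) fun t ht => hμν t ht.2
  have hsup (κ : Measure ℝ) : ∫⁻ x, f x ∂κ = ⨆ n : ℕ, ∫⁻ x, min (f x) n ∂κ := by
    rw [← lintegral_iSup (fun n => hf.measurable.min measurable_const) fun m n hmn x =>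
      min_le_min_left _ (by exact_mod_cast hmn)]
    refine lintegral_congr fun x => ?_
    rw [← inf_iSup_eq, ENNReal.iSup_natCast, inf_top_eq]
  rw [hsup, hsup]
  exact iSup_mono htrunc

lemma lintegral_expMeasure (ε : ℝ) {G : ℝ → ℝ≥0∞} (hG : Measurable G) :
    ∫⁻ x, G x ∂expMeasure ε =
      ∫⁻ x in Set.Ici 0, G x * ENNReal.ofReal (ε * Real.exp (-ε * x)) := by
  have hpdf : expMeasure ε = volume.withDensity (exponentialPDF ε) := rfl
  have hm : Measurable (exponentialPDF ε) := (measurable_exponentialPDFReal ε).ennreal_ofReal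
  rw [hpdf, lintegral_withDensity_eq_lintegral_mul _ hm hG,
    ← lintegral_indicator measurableSet_Ici]
  refine lintegral_congr fun x => ?_
  by_cases hx : 0 ≤ x
  · simp [exponentialPDF_of_nonneg hx, hx, mul_comm]
  · simp [exponentialPDF_of_neg (not_le.1 hx), hx]

lemma ae_expMeasure_nonneg (ε : ℝ) : ∀ᵐ x ∂expMeasure ε, 0 ≤ x := by
  have hneg : MeasurableSet {x : ℝ | ¬ 0 ≤ x} := measurableSet_Ici.compl
  rw [ae_iff, ← lintegral_indicator_one hneg,
    lintegral_expMeasure ε (measurable_one.indicator hneg)]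
  refine setLIntegral_eq_zero measurableSet_Ici fun x hx => ?_
  simp [Set.mem_Ici.1 hx]

lemma ofReal_mul_setLIntegral_Ici {ε : ℝ} (hε : 0 ≤ ε) {G : ℝ → ℝ≥0∞} (hG : Measurable G) (t : ℝ) :
    ENNReal.ofReal ε * ∫⁻ u in Set.Ici t, G u * ENNReal.ofReal (Real.exp (-ε * u)) =
      ENNReal.ofReal (Real.exp (-ε * t)) * ∫⁻ x, G (t + x) ∂expMeasure ε := by
  have hshift : (fun x : ℝ => t + x) ⁻¹' Set.Ici t = Set.Ici 0 := by simp
  rw [lintegral_expMeasure ε (by fun_prop), ← (measurePreserving_add_left volume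
      t).setLIntegral_comp_preimage measurableSet_Ici (by fun_prop), hshift,
    ← lintegral_const_mul _ (by fun_prop), ← lintegral_const_mul _ (by fun_prop)]
  refine lintegral_congr fun x => ?_
  rw [mul_add, ofReal_exp_add, ENNReal.ofReal_mul hε]
  ring

section Halfline

variable {ε : ℝ} {G ρ : ℝ → ℝ≥0∞} {c : ℝ≥0∞}

lemma mul_setLIntegral_le_of_isUpperSet (hε : 0 < ε) (hG : Measurable G) (hρ : LogLipschitz ε ρ)
    {U : Set ℝ} (hU : IsUpperSet U) (hc : ∀ t ∈ U, c ≤ ∫⁻ x, G (t + x) ∂expMeasure ε) :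
    c * ∫⁻ u in U, ρ u ≤ ∫⁻ u in U, G u * ρ u := by
  have := isProbabilityMeasure_expMeasure hε
  have hUm : MeasurableSet U := hU.ordConnected.measurableSet
  have hρm : Measurable ρ := hρ.continuous.measurable
  -- `ρ u` is the decaying weight `exp (-ε u)` times an increasing function of `u`.
  have hsplit (F : ℝ → ℝ≥0∞) (hF : Measurable F) : ∫⁻ u in U, F u * ρ u =
      ∫⁻ u in U, ENNReal.ofReal (Real.exp (ε * u)) * ρ u
        ∂volume.withDensity fun u => F u * ENNReal.ofReal (Real.exp (-ε * u)) := by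
    rw [setLIntegral_withDensity_eq_setLIntegral_mul _ (by fun_prop) (by fun_prop) hUm]
    refine lintegral_congr fun u => ?_
    rw [Pi.mul_apply, mul_assoc, ← mul_assoc (ENNReal.ofReal _), ← ofReal_exp_add]
    simp
  rw [← lintegral_const_mul _ hρm, hsplit _ measurable_const, hsplit G hG]
  refine setLIntegral_le_of_monotone hU (fun t ht => ?_) hρ.monotone_exp_mul
  have hε0 : ENNReal.ofReal ε ≠ 0 := by simpa using hε
  rw [withDensity_apply _ measurableSet_Ici, withDensity_apply _ measurableSet_Ici,
    ← ENNReal.mul_le_mul_iff_right hε0 ENNReal.ofReal_ne_top,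
    ofReal_mul_setLIntegral_Ici hε.le measurable_const, ofReal_mul_setLIntegral_Ici hε.le hG,
    lintegral_const, measure_univ, mul_one]
  exact mul_le_mul_right (hc t ht) _

lemma mul_setLIntegral_le_of_isLowerSet (hε : 0 < ε) (hG : Measurable G) (hρ : LogLipschitz ε ρ)
    {V : Set ℝ} (hV : IsLowerSet V) (hc : ∀ t ∈ V, c ≤ ∫⁻ x, G (t - x) ∂expMeasure ε) :
    c * ∫⁻ u in V, ρ u ≤ ∫⁻ u in V, G u * ρ u := by
  have hreflect (F : ℝ → ℝ≥0∞) : ∫⁻ u in Neg.neg ⁻¹' V, F (-u) = ∫⁻ u in V, F u :=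
    (Measure.measurePreserving_neg (volume : Measure ℝ)).setLIntegral_comp_preimage_emb
      (Homeomorph.neg ℝ).measurableEmbedding F V
  rw [← hreflect, ← hreflect fun u => G u * ρ u]
  refine mul_setLIntegral_le_of_isUpperSet (G := fun u => G (-u)) hε (by fun_prop) hρ.comp_neg
    (fun u v huv hu => hV (neg_le_neg huv) hu) fun t ht => ?_
  simpa only [neg_add, ← sub_eq_add_neg] using hc (-t) ht

/-- The points `q` where some left tail mean of `G` at `p ≤ q` falls short of `c` form an upper
set, on which the right tail means reach `c`; off this set the left tail means reach `c`. -/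
lemma mul_lintegral_le_of_two_mul_le (hε : 0 < ε) (hG : Measurable G) (hρ : LogLipschitz ε ρ)
    (hc : ∀ p q, p ≤ q →
      2 * c ≤ ∫⁻ x, G (p - x) ∂expMeasure ε + ∫⁻ x, G (q + x) ∂expMeasure ε) :
    c * ∫⁻ u, ρ u ≤ ∫⁻ u, G u * ρ u := by
  set U : Set ℝ := {q | ∃ p ≤ q, ∫⁻ x, G (p - x) ∂expMeasure ε < c}
  have hU : IsUpperSet U := fun x y hxy ⟨p, hp, hpc⟩ => ⟨p, hp.trans hxy, hpc⟩
  have hUm : MeasurableSet U := hU.ordConnected.measurableSet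
  have hright : c * ∫⁻ u in U, ρ u ≤ ∫⁻ u in U, G u * ρ u := by
    refine mul_setLIntegral_le_of_isUpperSet hε hG hρ hU ?_
    rintro q ⟨p, hpq, hp⟩
    by_contra! hq
    exact (hc p q hpq).not_gt ((ENNReal.add_lt_add hp hq).trans_eq (two_mul c).symm)
  have hleft : c * ∫⁻ u in Uᶜ, ρ u ≤ ∫⁻ u in Uᶜ, G u * ρ u :=
    mul_setLIntegral_le_of_isLowerSet hε hG hρ hU.compl fun t ht =>
      not_lt.1 fun hlt => ht ⟨t, le_rfl, hlt⟩
  rw [← lintegral_add_compl _ hUm, ← lintegral_add_compl (fun u => G u * ρ u) hUm, mul_add]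
  exact add_le_add hright hleft

end Halfline

section Laplace

variable {ε : ℝ}

lemma lintegral_laplace (ε u : ℝ) {G : ℝ → ℝ≥0∞} (hG : Measurable G) :
    ∫⁻ y, G y ∂laplace ε u =
      ∫⁻ y, G y * ENNReal.ofReal (ε / 2 * Real.exp (-ε * |y - u|)) := by
  rw [laplace, lintegral_withDensity_eq_lintegral_mul _ (by fun_prop) hG]
  exact lintegral_congr fun y => mul_comm _ _

lemma lintegral_laplace_eq_sub (ε u : ℝ) {G : ℝ → ℝ≥0∞} (hG : Measurable G) :
    ∫⁻ y, G y ∂laplace ε u = ∫⁻ y, G (u - y) ∂laplace ε 0 := by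
  rw [lintegral_laplace ε u hG, lintegral_laplace ε 0 (by fun_prop),
    ← lintegral_sub_left_eq_self _ u]
  refine lintegral_congr fun y => ?_
  rw [sub_zero, sub_sub_cancel_left, abs_neg]

lemma two_mul_lintegral_laplace (ε : ℝ) {G : ℝ → ℝ≥0∞} (hG : Measurable G) :
    2 * ∫⁻ y, G y ∂laplace ε 0 =
      ∫⁻ x, G (-x) ∂expMeasure ε + ∫⁻ x, G x ∂expMeasure ε := by
  have hdouble : 2 * ∫⁻ y, G y ∂laplace ε 0 =
      ∫⁻ y, G y * ENNReal.ofReal (ε * Real.exp (-ε * |y|)) := by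
    rw [lintegral_laplace ε 0 hG, ← lintegral_const_mul _ (by fun_prop)]
    refine lintegral_congr fun y => ?_
    rw [mul_left_comm, sub_zero, ← ENNReal.ofReal_ofNat 2, ← ENNReal.ofReal_mul zero_le_two,
      ← mul_assoc, mul_div_cancel₀ ε two_ne_zero]
  have hreflect : ∫⁻ y in Set.Iio 0, G y * ENNReal.ofReal (ε * Real.exp (-ε * |y|)) =
      ∫⁻ y in Set.Ici 0, G (-y) * ENNReal.ofReal (ε * Real.exp (-ε * |y|)) := by
    rw [← setLIntegral_congr Ioi_ae_eq_Ici,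
      ← (Measure.measurePreserving_neg (volume : Measure ℝ)).setLIntegral_comp_preimage_emb
        (Homeomorph.neg ℝ).measurableEmbedding _ (Set.Iio 0)]
    simp
  rw [hdouble, ← lintegral_add_compl _ (measurableSet_Ici (a := (0 : ℝ))), Set.compl_Ici,
    hreflect, lintegral_expMeasure ε hG, lintegral_expMeasure ε (by fun_prop), add_comm]
  congr 1 <;> exact setLIntegral_congr_fun measurableSet_Ici fun x hx => by
    simp only [abs_of_nonneg (Set.mem_Ici.1 hx)]

lemma isProbabilityMeasure_laplace (hε : 0 < ε) (u : ℝ) : IsProbabilityMeasure (laplace ε u) := by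
  have := isProbabilityMeasure_expMeasure hε
  have hmass := two_mul_lintegral_laplace ε (G := 1) measurable_one
  simp only [Pi.one_apply, lintegral_one, measure_univ, one_add_one_eq_two] at hmass
  have htrans := lintegral_laplace_eq_sub ε u (G := 1) measurable_one
  simp only [Pi.one_apply, lintegral_one] at htrans
  exact ⟨htrans.trans ((ENNReal.mul_eq_left two_ne_zero ENNReal.ofNat_ne_top).1 hmass)⟩

lemma logLipschitz_laplace_density (hε : 0 ≤ ε) (x : ℝ) :
    LogLipschitz ε fun u => ENNReal.ofReal (ε / 2 * Real.exp (-ε * |x - u|)) := by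
  simp only [ENNReal.ofReal_mul (div_nonneg hε zero_le_two)]
  refine (logLipschitz_ofReal_exp fun u v => ?_).const_mul _
  have htriangle : |x - v| ≤ |u - v| + |x - u| := (abs_sub_le x u v).trans_eq (add_comm _ _)
  linarith [mul_le_mul_of_nonneg_left htriangle hε]

lemma exists_logLipschitz_lintegral_eq_one (hε : 0 < ε) :
    ∃ w : ℝ → ℝ≥0∞, LogLipschitz ε w ∧ ∫⁻ u, w u = 1 := by
  refine ⟨_, logLipschitz_laplace_density hε.le 0, ?_⟩
  have hmass := (isProbabilityMeasure_laplace hε 0).measure_univ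
  rw [laplace, withDensity_apply _ MeasurableSet.univ, setLIntegral_univ] at hmass
  simpa only [abs_sub_comm (0 : ℝ)] using hmass

lemma laplace_mem_userActions (hε : 0 < ε) : laplace ε ∈ userActions ε ℝ := by
  refine ⟨isProbabilityMeasure_laplace hε, fun u v S hS => ?_⟩
  rw [laplace, laplace, withDensity_apply _ hS, withDensity_apply _ hS]
  exact LogLipschitz.lintegral (logLipschitz_laplace_density hε.le) (volume.restrict S) u v

end Laplace

/-- The densities of a private family `R` with respect to `R 0`, chosen so as to be
`ε`-log-Lipschitz in the user at every point. Radon-Nikodym derivatives have this property only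
almost everywhere, off a null set that depends on the two users being compared. Only the countably
many rational users are therefore kept, and the infimum is the largest `ε`-log-Lipschitz function
of `u` below the derivatives at these (the McShane extension, for logarithms). -/
noncomputable def geoDensity {Y : Type*} [MeasurableSpace Y] (ε : ℝ) (R : ℝ → Measure Y)
    (u : ℝ) (a : Y) : ℝ≥0∞ :=
  ⨅ q : ℚ, ENNReal.ofReal (Real.exp (ε * |u - q|)) * (R q).rnDeriv (R 0) a

lemma lintegral_lintegral_withDensity {X Y : Type*} [MeasurableSpace X] [MeasurableSpace Y]
    {μ : Measure Y} [SFinite μ] {ν : Measure X} [SFinite ν] {r F : X → Y → ℝ≥0∞} {w : X → ℝ≥0∞}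
    (hr : Measurable (Function.uncurry r)) (hw : Measurable w)
    (hF : Measurable (Function.uncurry F)) :
    ∫⁻ u, (∫⁻ a, F u a ∂(μ.withDensity (r u))) * w u ∂ν =
      ∫⁻ a, (∫⁻ u, F u a * (r u a * w u) ∂ν) ∂μ := by
  rw [lintegral_lintegral_swap ((hF.comp measurable_swap).mul
    ((hr.comp measurable_swap).mul (hw.comp measurable_snd))).aemeasurable]
  refine lintegral_congr fun u => ?_
  have hFu : Measurable (F u) := hF.of_uncurry_left
  have hru : Measurable (r u) := hr.of_uncurry_left
  rw [lintegral_withDensity_eq_lintegral_mul _ hru hFu, ← lintegral_mul_const _ (hru.mul hFu)]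
  refine lintegral_congr fun a => ?_
  rw [Pi.mul_apply, mul_comm (r u a), mul_assoc]

section Density

variable {Y : Type*} [MeasurableSpace Y] {ε : ℝ} {R : ℝ → Measure Y}

lemma measurable_uncurry_geoDensity (ε : ℝ) (R : ℝ → Measure Y) :
    Measurable (Function.uncurry (geoDensity ε R)) :=
  Measurable.iInf fun q => Measurable.mul (by fun_prop)
    ((Measure.measurable_rnDeriv (R q) (R 0)).comp measurable_snd)

lemma logLipschitz_geoDensity (hε : 0 ≤ ε) (R : ℝ → Measure Y) (a : Y) :
    LogLipschitz ε fun u => geoDensity ε R u a := by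
  refine LogLipschitz.iInf fun q => ?_
  refine (logLipschitz_ofReal_exp fun u v => ?_).mul_const _
  rw [← mul_add]
  exact mul_le_mul_of_nonneg_left (abs_sub_le u v q) hε

namespace GeoDP

lemma logLipschitz (hR : GeoDP ε R) {S : Set Y} (hS : MeasurableSet S) :
    LogLipschitz ε fun u => R u S :=
  fun u v => hR u v S hS

lemma measure_le (hR : GeoDP ε R) (u v : ℝ) :
    R u ≤ ENNReal.ofReal (Real.exp (ε * |u - v|)) • R v :=
  Measure.le_iff.2 fun S hS => hR u v S hS

lemma bind {X : Type*} [MeasurableSpace X] (hR : GeoDP ε R) (Q : Kernel Y X) :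
    GeoDP ε fun u => (R u).bind Q := fun u v S hS => by
  rw [Measure.bind_apply hS Q.aemeasurable, Measure.bind_apply hS Q.aemeasurable,
    ← smul_eq_mul, ← lintegral_smul_measure]
  exact lintegral_mono' (hR.measure_le u v) le_rfl

lemma absolutelyContinuous (hR : GeoDP ε R) (u v : ℝ) : R u ≪ R v :=
  Measure.absolutelyContinuous_of_le_smul (hR.measure_le u v)

variable [∀ u, IsFiniteMeasure (R u)]

lemma withDensity_rnDeriv (hR : GeoDP ε R) (u : ℝ) :
    (R 0).withDensity ((R u).rnDeriv (R 0)) = R u :=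
  Measure.withDensity_rnDeriv_eq _ _ (hR.absolutelyContinuous u 0)

lemma ae_rnDeriv_le (hR : GeoDP ε R) (u v : ℝ) : ∀ᵐ a ∂(R 0),
    (R u).rnDeriv (R 0) a ≤
      ENNReal.ofReal (Real.exp (ε * |u - v|)) * (R v).rnDeriv (R 0) a := by
  have hm (w : ℝ) : Measurable ((R w).rnDeriv (R 0)) := Measure.measurable_rnDeriv _ _
  refine ae_le_of_forall_setLIntegral_le_of_sigmaFinite (hm u) fun S hS _ => ?_
  rw [lintegral_const_mul _ (hm v), ← withDensity_apply _ hS, ← withDensity_apply _ hS,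
    hR.withDensity_rnDeriv, hR.withDensity_rnDeriv]
  exact hR u v S hS

lemma withDensity_geoDensity_ratCast (hR : GeoDP ε R) (p : ℚ) :
    (R 0).withDensity (geoDensity ε R p) = R p := by
  rw [← hR.withDensity_rnDeriv p]
  refine withDensity_congr_ae ?_
  filter_upwards [ae_all_iff.2 fun q : ℚ => hR.ae_rnDeriv_le p q] with a ha
  exact le_antisymm ((iInf_le _ p).trans_eq (by simp)) (le_iInf ha)

lemma withDensity_geoDensity (hε : 0 ≤ ε) (hR : GeoDP ε R) (u : ℝ) :
    (R 0).withDensity (geoDensity ε R u) = R u := by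
  refine Measure.ext fun S hS => ?_
  rw [withDensity_apply _ hS]
  have hcont : Continuous fun v => ∫⁻ a in S, geoDensity ε R v a ∂(R 0) :=
    (LogLipschitz.lintegral (logLipschitz_geoDensity hε R) _).continuous
  refine congrFun (Rat.denseRange_cast.equalizer hcont (hR.logLipschitz hS).continuous ?_) u
  funext p
  simp only [Function.comp_apply]
  rw [← withDensity_apply _ hS, hR.withDensity_geoDensity_ratCast]

end GeoDP

lemma GeoDP.le_iSup_lintegral [∀ u, IsProbabilityMeasure (R u)] (hε : 0 ≤ ε) (hR : GeoDP ε R)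
    {δ : ℝ} {w : ℝ → ℝ≥0∞} (hw : LogLipschitz δ w) (hw_one : ∫⁻ u, w u = 1)
    {D : ℝ → Y → ℝ≥0∞} (hD : Measurable (Function.uncurry D)) {c : ℝ≥0∞}
    (hc : ∀ a ρ, LogLipschitz (ε + δ) ρ → c * ∫⁻ u, ρ u ≤ ∫⁻ u, D u a * ρ u) :
    c ≤ ⨆ u, ∫⁻ a, D u a ∂(R u) := by
  have hwm : Measurable w := hw.continuous.measurable
  have hswap {F : ℝ → Y → ℝ≥0∞} (hF : Measurable (Function.uncurry F)) :
      ∫⁻ u, (∫⁻ a, F u a ∂(R u)) * w u =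
        ∫⁻ a, (∫⁻ u, F u a * (geoDensity ε R u a * w u)) ∂(R 0) := by
    rw [← lintegral_lintegral_withDensity (measurable_uncurry_geoDensity ε R) hwm hF]
    simp only [hR.withDensity_geoDensity hε]
  calc c = ∫⁻ u, (∫⁻ _, c ∂(R u)) * w u := by
        simp only [lintegral_const, measure_univ, mul_one, lintegral_const_mul _ hwm, hw_one]
    _ = ∫⁻ a, (∫⁻ u, c * (geoDensity ε R u a * w u)) ∂(R 0) := hswap measurable_const
    _ ≤ ∫⁻ a, (∫⁻ u, D u a * (geoDensity ε R u a * w u)) ∂(R 0) := by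
        refine lintegral_mono fun a => ?_
        have hρ := (logLipschitz_geoDensity hε R a).mul hw
        exact (lintegral_const_mul _ hρ.continuous.measurable).trans_le (hc a _ hρ)
    _ = ∫⁻ u, (∫⁻ a, D u a ∂(R u)) * w u := (hswap hD).symm
    _ ≤ ∫⁻ u, (⨆ v, ∫⁻ a, D v a ∂(R v)) * w u :=
        lintegral_mono fun u => mul_le_mul_left (le_iSup (fun v => ∫⁻ a, D v a ∂(R v)) u) _
    _ = ⨆ u, ∫⁻ a, D u a ∂(R u) := by rw [lintegral_const_mul _ hwm, hw_one, mul_one]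

end Density

section Disutility

variable {h : ℝ → ℝ} {k : ℕ}

lemma measurable_ofReal_comp_abs (hmono : MonotoneOn h (Set.Ici 0)) :
    Measurable fun x => ENNReal.ofReal (h |x|) := by
  have hmax : Monotone fun x => h (max x 0) := fun x y hxy =>
    hmono (le_max_right x 0) (le_max_right y 0) (max_le_max_right 0 hxy)
  simpa using (hmax.measurable.comp (measurable_id.abs (α := ℝ))).ennreal_ofReal

lemma measurable_uncurry_minDisutility (hmono : MonotoneOn h (Set.Ici 0)) (k : ℕ) :
    Measurable (Function.uncurry (minDisutility (k := k) h)) :=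
  Measurable.iInf fun i => (measurable_ofReal_comp_abs hmono).comp
    (by fun_prop : Measurable fun p : ℝ × (Fin k → ℝ) => p.1 - p.2 i)

lemma measurable_minDisutility (hmono : MonotoneOn h (Set.Ici 0)) (u : ℝ) :
    Measurable (minDisutility (k := k) h u) :=
  (measurable_uncurry_minDisutility hmono k).of_uncurry_left

lemma measurable_minDisutility_left (hmono : MonotoneOn h (Set.Ici 0)) (a : Fin k → ℝ) :
    Measurable fun u => minDisutility h u a :=
  (measurable_uncurry_minDisutility hmono k).of_uncurry_right

lemma minDisutility_comp_le (hmono : MonotoneOn h (Set.Ici 0)) {c : ℝ → ℝ}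
    (hc : LipschitzWith 1 c) (u : ℝ) (a : Fin k → ℝ) :
    minDisutility h (c u) (c ∘ a) ≤ minDisutility h u a := by
  refine iInf_mono fun i => ENNReal.ofReal_le_ofReal ?_
  exact hmono (Set.mem_Ici.2 (abs_nonneg _)) (Set.mem_Ici.2 (abs_nonneg _))
    (by simpa [Real.dist_eq] using hc.dist_le_mul u (a i))

/-- The signed displacement of `x` from the interval `[p, q]`: it contracts `[p, q]` to the
point `0` and translates the two half-lines outside it. -/
def collapse (p q x : ℝ) : ℝ :=
  x - max p (min x q)

lemma lipschitzWith_collapse (p q : ℝ) : LipschitzWith 1 (collapse p q) := by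
  refine LipschitzWith.mk_one fun x y => ?_
  simp only [Real.dist_eq, collapse]
  grind

lemma collapse_sub {p q x : ℝ} (hpq : p ≤ q) (hx : 0 ≤ x) : collapse p q (p - x) = -x := by
  grind [collapse]

lemma collapse_add {p q x : ℝ} (hpq : p ≤ q) (hx : 0 ≤ x) : collapse p q (q + x) = x := by
  grind [collapse]

/-- Contracting `[p, q]` to a point turns the two exponential tails that issue from `p` and `q`
into one Laplace distribution, and brings no result farther from any user. -/
lemma two_mul_fHat_le (hmono : MonotoneOn h (Set.Ici 0)) (ε : ℝ) (a : Fin k → ℝ) {p q : ℝ}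
    (hpq : p ≤ q) :
    2 * fHat ε k h ≤ ∫⁻ x, minDisutility h (p - x) a ∂expMeasure ε +
      ∫⁻ x, minDisutility h (q + x) a ∂expMeasure ε := by
  have hcollapse := minDisutility_comp_le (k := k) hmono (lipschitzWith_collapse p q)
  calc 2 * fHat ε k h ≤ 2 * laplaceObjective ε h (collapse p q ∘ a) :=
        mul_le_mul_right (iInf_le _ _) 2
    _ = ∫⁻ x, minDisutility h (-x) (collapse p q ∘ a) ∂expMeasure ε +
          ∫⁻ x, minDisutility h x (collapse p q ∘ a) ∂expMeasure ε :=
        two_mul_lintegral_laplace ε (measurable_minDisutility_left hmono _)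
    _ ≤ _ := by
        refine add_le_add (lintegral_mono_ae ?_) (lintegral_mono_ae ?_)
        · filter_upwards [ae_expMeasure_nonneg ε] with x hx
          simpa only [collapse_sub hpq hx] using hcollapse (p - x) a
        · filter_upwards [ae_expMeasure_nonneg ε] with x hx
          simpa only [collapse_add hpq hx] using hcollapse (q + x) a

lemma fHat_mul_lintegral_le {ε : ℝ} (hε : 0 < ε) (hmono : MonotoneOn h (Set.Ici 0))
    (a : Fin k → ℝ) {ρ : ℝ → ℝ≥0∞} (hρ : LogLipschitz ε ρ) :
    fHat ε k h * ∫⁻ u, ρ u ≤ ∫⁻ u, minDisutility h u a * ρ u :=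
  mul_lintegral_le_of_two_mul_le hε (measurable_minDisutility_left hmono a) hρ
    fun _ _ hpq => two_mul_fHat_le hmono ε a hpq

lemma userCost_eq_lintegral_bind (hmono : MonotoneOn h (Set.Ici 0)) {Z : Type*}
    [MeasurableSpace Z] (P : ℝ → Measure Z) (Q : Kernel Z (Fin k → ℝ)) (u : ℝ) :
    userCost h P Q u = ∫⁻ a, minDisutility h u a ∂(P u).bind Q :=
  (Measure.lintegral_bind Q.aemeasurable (measurable_minDisutility hmono u).aemeasurable).symm

lemma fHat_add_le_cost {ε δ : ℝ} (hε : 0 ≤ ε) (hδ : 0 < δ) (hmono : MonotoneOn h (Set.Ici 0))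
    {Z : Type*} [MeasurableSpace Z] {P : ℝ → Measure Z} (hP : P ∈ userActions ε Z)
    (Q : Kernel Z (Fin k → ℝ)) [IsMarkovKernel Q] : fHat (ε + δ) k h ≤ cost h P Q := by
  have hPprob (u : ℝ) : IsProbabilityMeasure (P u) := hP.1 u
  have hbind (u : ℝ) : IsProbabilityMeasure ((P u).bind Q) :=
    isProbabilityMeasure_bind Q.aemeasurable (ae_of_all _ inferInstance)
  obtain ⟨w, hw, hw_one⟩ := exists_logLipschitz_lintegral_eq_one hδ
  simp only [cost, userCost_eq_lintegral_bind hmono]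
  exact (hP.2.bind Q).le_iSup_lintegral hε hw hw_one (measurable_uncurry_minDisutility hmono k)
    fun a ρ hρ => fHat_mul_lintegral_le (add_pos_of_nonneg_of_pos hε hδ) hmono a hρ

end Disutility

section Semicontinuity

lemma lowerSemicontinuous_iInf_of_finite {ι X γ : Type*} [Finite ι] [TopologicalSpace X]
    [CompleteLinearOrder γ] [DenselyOrdered γ] {f : ι → X → γ}
    (hf : ∀ i, LowerSemicontinuous (f i)) : LowerSemicontinuous fun x => ⨅ i, f i x := by
  intro x c hc
  obtain ⟨d, hcd, hd⟩ := exists_between hc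
  filter_upwards [eventually_all.2 fun i => hf i x d (hd.trans_le (iInf_le _ i))] with y hy
  exact hcd.trans_le (le_iInf fun i => (hy i).le)

lemma lowerSemicontinuous_ennreal_mul {X : Type*} [TopologicalSpace X] {f g : X → ℝ≥0∞}
    (hf : LowerSemicontinuous f) (hg : LowerSemicontinuous g) :
    LowerSemicontinuous fun x => f x * g x :=
  lowerSemicontinuous_iff_le_liminf.2 fun x =>
    (mul_le_mul' (hf.le_liminf x) (hg.le_liminf x)).trans ENNReal.le_liminf_mul

lemma lowerSemicontinuous_lintegral {X Y : Type*} [TopologicalSpace X] [FirstCountableTopology X]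
    [MeasurableSpace Y] {f : X → Y → ℝ≥0∞} (hm : ∀ x, Measurable (f x))
    (hf : ∀ y, LowerSemicontinuous fun x => f x y) (μ : Measure Y) :
    LowerSemicontinuous fun x => ∫⁻ y, f x y ∂μ :=
  lowerSemicontinuous_iff_le_liminf.2 fun x =>
    (lintegral_mono fun y => (hf y).le_liminf x).trans (lintegral_liminf_le hm)

lemma exists_eq_iInf_of_lowerSemicontinuous {Y γ : Type*} [TopologicalSpace Y] [CompactSpace Y]
    [Nonempty Y] [CompleteLinearOrder γ] {f : Y → γ} (hf : LowerSemicontinuous f) :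
    ∃ y, f y = ⨅ z, f z := by
  obtain ⟨y, -, hy⟩ := (hf.lowerSemicontinuousOn Set.univ).exists_isMinOn Set.univ_nonempty
    isCompact_univ
  exact ⟨y, le_antisymm (le_iInf fun z => hy (Set.mem_univ z)) (iInf_le f y)⟩

lemma lowerSemicontinuous_iInf_of_compactSpace {X Y γ : Type*} [TopologicalSpace X]
    [TopologicalSpace Y] [CompactSpace Y] [Nonempty Y] [CompleteLinearOrder γ] {F : X × Y → γ}
    (hF : LowerSemicontinuous F) : LowerSemicontinuous fun x => ⨅ y, F (x, y) := by
  refine lowerSemicontinuous_iff_isClosed_preimage.2 fun c => ?_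
  have himage : (fun x => ⨅ y, F (x, y)) ⁻¹' Set.Iic c = Prod.fst '' (F ⁻¹' Set.Iic c) := by
    refine Set.Subset.antisymm (fun x hx => ?_) ?_
    · obtain ⟨y, hy⟩ := exists_eq_iInf_of_lowerSemicontinuous
        (hF.comp (Continuous.prodMk_right x))
      exact ⟨(x, y), hy.trans_le hx, rfl⟩
    · rintro _ ⟨⟨x, y⟩, hp, rfl⟩
      exact (iInf_le _ y).trans hp
  rw [himage]
  exact isClosedMap_fst_of_compactSpace _ (hF.isClosed_preimage c)

variable {h : ℝ → ℝ} {k : ℕ}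

lemma lowerSemicontinuous_comp_abs (hlsc : LowerSemicontinuousOn h (Set.Ici 0)) :
    LowerSemicontinuous fun x => h |x| := fun x c hc => by
  have habs : Tendsto (fun x : ℝ => |x|) (𝓝 x) (𝓝[Set.Ici 0] |x|) :=
    tendsto_nhdsWithin_iff.2 ⟨continuous_abs.tendsto x, .of_forall abs_nonneg⟩
  exact habs.eventually (hlsc |x| (abs_nonneg x) c hc)

/-- A result that escapes to `±∞` may be replaced by `0 = EReal.toReal (±∞)`: in the limit it is
at least as far from the user `y` as any given point. -/
lemma lowerSemicontinuous_comp_abs_sub_toReal (hlsc : LowerSemicontinuousOn h (Set.Ici 0))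
    (hmono : MonotoneOn h (Set.Ici 0)) (y : ℝ) :
    LowerSemicontinuous fun b : EReal => h |y - b.toReal| := by
  intro b c hc
  have hfar (hev : ∀ᶠ b' in 𝓝 b, |y - b.toReal| ≤ |y - b'.toReal|) :
      ∀ᶠ b' : EReal in 𝓝 b, c < h |y - b'.toReal| :=
    hev.mono fun b' hb' => hc.trans_le
      (hmono (Set.mem_Ici.2 (abs_nonneg _)) (Set.mem_Ici.2 (abs_nonneg _)) hb')
  induction b with
  | bot =>
    refine hfar ?_
    filter_upwards [Iio_mem_nhds (EReal.bot_lt_coe (y - |y|))] with b' hb'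
    induction b' with
    | bot => rfl
    | top => simp at hb'
    | coe x =>
      have hx : x < y - |y| := by simpa only [Set.mem_Iio, EReal.coe_lt_coe_iff] using hb'
      simpa using (by linarith : |y| ≤ y - x).trans (le_abs_self (y - x))
  | top =>
    refine hfar ?_
    filter_upwards [Ioi_mem_nhds (EReal.coe_lt_top (y + |y|))] with b' hb'
    induction b' with
    | bot => simp at hb'
    | top => rfl
    | coe x =>
      have hx : y + |y| < x := by simpa only [Set.mem_Ioi, EReal.coe_lt_coe_iff] using hb'
      simpa using (by linarith : |y| ≤ -(y - x)).trans (neg_le_abs (y - x))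
  | coe x =>
    have hlim : Tendsto (fun b' : EReal => y - b'.toReal) (𝓝 x) (𝓝 (y - x)) :=
      (EReal.tendsto_toReal (EReal.coe_ne_top x) (EReal.coe_ne_bot x)).const_sub y
    exact hlim.eventually (lowerSemicontinuous_comp_abs hlsc (y - x) c hc)

lemma lowerSemicontinuous_minDisutility_toReal (hlsc : LowerSemicontinuousOn h (Set.Ici 0))
    (hmono : MonotoneOn h (Set.Ici 0)) (y : ℝ) :
    LowerSemicontinuous fun b : Fin k → EReal => minDisutility h y fun i => (b i).toReal :=
  lowerSemicontinuous_iInf_of_finite fun i =>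
    ENNReal.continuous_ofReal.comp_lowerSemicontinuous
      ((lowerSemicontinuous_comp_abs_sub_toReal hlsc hmono y).comp (continuous_apply i))
      ENNReal.ofReal_mono

lemma lowerSemicontinuous_laplaceObjective_toReal (hlsc : LowerSemicontinuousOn h (Set.Ici 0))
    (hmono : MonotoneOn h (Set.Ici 0)) :
    LowerSemicontinuous fun p : ℝ × (Fin k → EReal) =>
      laplaceObjective p.1 h fun i => (p.2 i).toReal := by
  have hdis (b : Fin k → EReal) : Measurable fun y => minDisutility h y fun i => (b i).toReal :=
    measurable_minDisutility_left hmono _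
  have hint (p : ℝ × (Fin k → EReal)) :
      Measurable fun y => (minDisutility h y fun i => (p.2 i).toReal) *
        ENNReal.ofReal (p.1 / 2 * Real.exp (-p.1 * |y - 0|)) :=
    (hdis p.2).mul (by fun_prop)
  simp only [laplaceObjective, lintegral_laplace _ 0 (hdis _)]
  refine lowerSemicontinuous_lintegral hint (fun y => ?_) volume
  have hdensity : Continuous fun p : ℝ × (Fin k → EReal) =>
      ENNReal.ofReal (p.1 / 2 * Real.exp (-p.1 * |y - 0|)) :=
    ENNReal.continuous_ofReal.comp (by fun_prop)
  have hdisutility := (lowerSemicontinuous_minDisutility_toReal (k := k) hlsc hmono y).comp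
    (continuous_snd (X := ℝ))
  exact lowerSemicontinuous_ennreal_mul hdisutility hdensity.lowerSemicontinuous

lemma fHat_eq_iInf_toReal (ε : ℝ) (k : ℕ) (h : ℝ → ℝ) :
    fHat ε k h = ⨅ b : Fin k → EReal, laplaceObjective ε h fun i => (b i).toReal :=
  le_antisymm (le_iInf fun _ => iInf_le _ _)
    (le_iInf fun a => (iInf_le _ fun i => (a i : EReal)).trans_eq (by simp))

lemma exists_laplaceObjective_eq_fHat (hlsc : LowerSemicontinuousOn h (Set.Ici 0))
    (hmono : MonotoneOn h (Set.Ici 0)) (ε : ℝ) :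
    ∃ a : Fin k → ℝ, laplaceObjective ε h a = fHat ε k h := by
  obtain ⟨b, hb⟩ := exists_eq_iInf_of_lowerSemicontinuous
    ((lowerSemicontinuous_laplaceObjective_toReal (k := k) hlsc hmono).comp
      (Continuous.prodMk_right ε))
  exact ⟨fun i => (b i).toReal, hb.trans (fHat_eq_iInf_toReal ε k h).symm⟩

lemma lowerSemicontinuous_fHat (hlsc : LowerSemicontinuousOn h (Set.Ici 0))
    (hmono : MonotoneOn h (Set.Ici 0)) (k : ℕ) : LowerSemicontinuous fun ε => fHat ε k h := by
  simp only [fHat_eq_iInf_toReal]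
  exact lowerSemicontinuous_iInf_of_compactSpace
    (lowerSemicontinuous_laplaceObjective_toReal hlsc hmono)

end Semicontinuity

section Optimality

variable {ε : ℝ} {h : ℝ → ℝ} {k : ℕ} {Z : Type*} [MeasurableSpace Z] {P : ℝ → Measure Z}

lemma fHat_le_cost (hε : 0 ≤ ε) (hlsc : LowerSemicontinuousOn h (Set.Ici 0))
    (hmono : MonotoneOn h (Set.Ici 0)) (hP : P ∈ userActions ε Z) (Q : Kernel Z (Fin k → ℝ))
    [IsMarkovKernel Q] : fHat ε k h ≤ cost h P Q := by
  by_contra! hlt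
  have hnear : ∀ᶠ s in 𝓝[>] ε, cost h P Q < fHat s k h :=
    (lowerSemicontinuous_fHat hlsc hmono k ε _ hlt).filter_mono nhdsWithin_le_nhds
  obtain ⟨s, hs, hεs⟩ := (hnear.and self_mem_nhdsWithin).exists
  have hle := fHat_add_le_cost hε (sub_pos.2 hεs) hmono hP Q
  rw [add_sub_cancel] at hle
  exact hs.not_ge hle

lemma fHat_le_bestResponseCost (hε : 0 ≤ ε) (hlsc : LowerSemicontinuousOn h (Set.Ici 0))
    (hmono : MonotoneOn h (Set.Ici 0)) (hP : P ∈ userActions ε Z) :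
    fHat ε k h ≤ bestResponseCost k h P :=
  le_iInf₂ fun Q _ => fHat_le_cost hε hlsc hmono hP Q

lemma fHat_le_optimalCost (hε : 0 ≤ ε) (hlsc : LowerSemicontinuousOn h (Set.Ici 0))
    (hmono : MonotoneOn h (Set.Ici 0)) : fHat ε k h ≤ optimalCost.{v} ε k h :=
  le_iInf₂ fun _ _ => le_iInf₂ fun _ hP => fHat_le_bestResponseCost hε hlsc hmono hP

lemma exists_isMarkovKernel_cost_eq_laplaceObjective (hmono : MonotoneOn h (Set.Ici 0))
    (a : Fin k → ℝ) {e : Z → ℝ} (he : Measurable e) (hP : ∀ u, (P u).map e = laplace ε u) :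
    ∃ Q : Kernel Z (Fin k → ℝ), IsMarkovKernel Q ∧ cost h P Q = laplaceObjective ε h a := by
  have hserver : Measurable fun s : Z => fun i : Fin k => e s + a i := by fun_prop
  refine ⟨Kernel.deterministic _ hserver, inferInstance, ?_⟩
  have huser (u : ℝ) :
      userCost h P (Kernel.deterministic _ hserver) u = laplaceObjective ε h a := by
    have hm : Measurable fun y : ℝ => minDisutility h u fun i => y + a i :=
      (measurable_minDisutility hmono u).comp (by fun_prop)
    calc userCost h P (Kernel.deterministic _ hserver) u
        = ∫⁻ s, minDisutility h u (fun i => e s + a i) ∂P u := lintegral_congr fun s =>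
          Kernel.lintegral_deterministic' hserver (measurable_minDisutility hmono u)
      _ = ∫⁻ y, minDisutility h u (fun i => y + a i) ∂laplace ε u := by
          rw [← hP u, lintegral_map hm he]
      _ = ∫⁻ y, minDisutility h u (fun i => u - y + a i) ∂laplace ε 0 :=
          lintegral_laplace_eq_sub ε u hm
      _ = laplaceObjective ε h a := by
          simp only [laplaceObjective, minDisutility, ← sub_sub, sub_sub_cancel]
  simp only [cost, huser, ciSup_const]

lemma map_mem_userActions {Y : Type*} [MeasurableSpace Y] (hP : P ∈ userActions ε Z) {e : Z → Y}
    (he : Measurable e) : (fun u => (P u).map e) ∈ userActions ε Y := by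
  refine ⟨fun u => ?_, fun u v S hS => ?_⟩
  · have := hP.1 u
    exact Measure.isProbabilityMeasure_map he.aemeasurable
  · rw [Measure.map_apply he hS, Measure.map_apply he hS]
    exact hP.2 u v _ (he hS)

lemma optimalCost_le_laplaceObjective (hε : 0 < ε) (hmono : MonotoneOn h (Set.Ici 0))
    (a : Fin k → ℝ) : optimalCost.{v} ε k h ≤ laplaceObjective ε h a := by
  have hup : Measurable (ULift.up : ℝ → ULift.{v} ℝ) := measurable_up
  obtain ⟨Q, hQ, hcost⟩ := exists_isMarkovKernel_cost_eq_laplaceObjective hmono a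
    (P := fun u => (laplace ε u).map (ULift.up.{v} : ℝ → ULift.{v} ℝ)) measurable_down
    fun u => (Measure.map_map measurable_down hup).trans Measure.map_id
  have hmem := map_mem_userActions (laplace_mem_userActions hε) hup
  calc optimalCost.{v} ε k h
      ≤ bestResponseCost k h fun u => (laplace ε u).map (ULift.up.{v} : ℝ → ULift.{v} ℝ) :=
        iInf_le_of_le (ULift.{v} ℝ) (iInf_le_of_le inferInstance (iInf₂_le _ hmem))
    _ ≤ cost h _ Q := iInf₂_le Q hQ
    _ = laplaceObjective ε h a := hcost

end Optimality

theorem theorem4_general (ε : ℝ) (hε : 0 < ε) (k : ℕ) (h : ℝ → ℝ)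
    (hlsc : LowerSemicontinuousOn h (Set.Ici 0)) (hmono : MonotoneOn h (Set.Ici 0))
    (_ : 0 ≤ h 0) :
    laplace ε ∈ userActions ε ℝ ∧
    bestResponseCost k h (laplace ε) = optimalCost.{v} ε k h ∧
    (∃ Q : Kernel ℝ (Fin k → ℝ), IsMarkovKernel Q ∧
      cost h (laplace ε) Q = optimalCost.{v} ε k h) ∧
    optimalCost.{v} ε k h = fHat ε k h ∧
    ∃ a : Fin k → ℝ, laplaceObjective ε h a = fHat ε k h := by
  have hlaplace := laplace_mem_userActions hε
  obtain ⟨a, ha⟩ := exists_laplaceObjective_eq_fHat (k := k) hlsc hmono ε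
  obtain ⟨Q, hQ, hcost⟩ := exists_isMarkovKernel_cost_eq_laplaceObjective hmono a
    measurable_id fun u => Measure.map_id (μ := laplace ε u)
  have hopt : optimalCost.{v} ε k h = fHat ε k h :=
    ((optimalCost_le_laplaceObjective hε hmono a).trans_eq ha).antisymm
      (fHat_le_optimalCost hε.le hlsc hmono)
  have hbest : bestResponseCost k h (laplace ε) = fHat ε k h :=
    ((iInf₂_le Q hQ).trans_eq (hcost.trans ha)).antisymm
      (fHat_le_bestResponseCost hε.le hlsc hmono hlaplace)
  exact ⟨hlaplace, hbest.trans hopt.symm, ⟨Q, hQ, (hcost.trans ha).trans hopt.symm⟩, hopt, a, ha⟩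

/-- For every signal universe: Laplace noise is a private user action; its best-response cost is
the optimal multi-selection cost, and some server response attains it; the optimal cost equals
`fHat`, and the infimum that defines `fHat` is attained. -/
theorem theorem4 (ε : ℝ) (hε : 0 < ε) (k : ℕ) (hk : 1 ≤ k) (h : ℝ → ℝ) (hh : Admissible h) :
    laplace ε ∈ userActions ε ℝ ∧
    bestResponseCost k h (laplace ε) = optimalCost.{v} ε k h ∧
    (∃ Q : Kernel ℝ (Fin k → ℝ), IsMarkovKernel Q ∧
      cost h (laplace ε) Q = optimalCost.{v} ε k h) ∧
    optimalCost.{v} ε k h = fHat ε k h ∧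
    ∃ a : Fin k → ℝ, laplaceObjective ε h a = fHat ε k h := by
  exact theorem4_general ε hε k h hh.continuousOn.lowerSemicontinuousOn hh.monotoneOn
    hh.map_zero.ge
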